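/- Let $d\ge 1$ and let $X_1,\dots,X_d$ be i.i.d. random variables that are almost surely positive, have a density $f_1$ with respect to Lebesgue measure, and have right-unbounded support, i.e. $\overline F(x)=\mathbb P(X_1>x)>0$ for all $x$. Write $S(\mathbf x)=x_1+\dots+x_d$, $f(\mathbf x)=\prod_{i=1}^d f_1(x_i)$ and $\ell(\gamma)=\mathbb P(S(\mathbf X)>\gamma)$. For each $\gamma$ let $$\pi(\mathbf x)=\frac{\mathbf 1\{S(\mathbf x)>\gamma\}\,f(\mathbf x)}{\ell(\gamma)},$$ let $\pi_1,\dots,\pi_d$ be the one-dimensional marginal densities of $\pi$, let $g(\mathbf x)=\prod_{i=1}^d\pi_i(x_i)$, and let $$Z(\gamma)=\mathbf 1\{S(\mathbf Y)>\gamma\}\,\frac{f(\mathbf Y)}{g(\mathbf Y)},\qquad \mathbf Y\sim g .$$ Suppose that the common distribution of the $X_i$ is one of the following: 1. (light-tailed, exponential class) for some $\theta>0$, $\lim_{\gamma\to\infty}\overline F(\gamma+x)/\overline F(\gamma)=e^{-\theta x}$ for every $x\in\mathbb R$; 2. (subexponential Weibull) $f_1(x)=\alpha x^{\alpha-1}e^{-x^\alpha}$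 for $x>0$, with $0<\alpha<1$; 3. (Pareto) $f_1(x)=\alpha x^{-\alpha-1}$ for $x\ge1$, with $\alpha>0$. Then the estimator $Z(\gamma)$ of $\ell(\gamma)$ is logarithmically efficient: $$\lim_{\gamma\to\infty}\frac{\mathbb E\,Z(\gamma)^2}{\ell(\gamma)^{2-\varepsilon}}=0\qquad\text{for every }\varepsilon>0 .$$ -/

import Mathlib

open MeasureTheory ProbabilityTheory Filter Topology
open scoped ENNReal NNReal

namespace SemiparametricCE

/-- The law on the real line with Lebesgue density `f₁`. -/
noncomputable def densityLaw (f₁ : ℝ → ℝ≥0) : Measure ℝ :=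
  volume.withDensity (fun x => (f₁ x : ℝ≥0∞))

/-- The exponential class `L(θ)`: the tail satisfies
`μ (γ + x, ∞) / μ (γ, ∞) → exp (-θ x)` as `γ → ∞`, for every real `x`. -/
def ExponentialClass (θ : ℝ) (μ : Measure ℝ) : Prop :=
  ∀ x : ℝ, Tendsto (fun γ : ℝ => μ.real (Set.Ioi (γ + x)) / μ.real (Set.Ioi γ)) atTop
    (𝓝 (Real.exp (-(θ * x))))

/-- The Weibull law with density `α x ^ (α - 1) exp (-x ^ α)` on `x > 0`. -/
noncomputable def weibullLaw (α : ℝ) : Measure ℝ :=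
  volume.withDensity (fun x => ENNReal.ofReal
    (if 0 < x then α * x ^ (α - 1) * Real.exp (-(x ^ α)) else 0))

/-- The Pareto law with density `α / x ^ (α + 1)` on `x ≥ 1`. -/
noncomputable def paretoLaw (α : ℝ) : Measure ℝ :=
  volume.withDensity (fun x => ENNReal.ofReal
    (if 1 ≤ x then α / x ^ (α + 1) else 0))

/-- The rare event `{x : S(x) > γ}`, where `S(x) = x₁ + ⋯ + x_d`. -/
def rareEvent (d : ℕ) (γ : ℝ) : Set (Fin d → ℝ) := {x | γ < ∑ i, x i}

/-- The probability `ℓ(γ) = P(S(X) > γ)`. -/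
noncomputable def rareProb {Ω : Type*} [MeasurableSpace Ω] {d : ℕ} (P : Measure Ω)
    (X : Fin d → Ω → ℝ) (γ : ℝ) : ℝ≥0∞ :=
  P {ω | (fun i => X i ω) ∈ rareEvent d γ}

/-- The joint density `f(x) = ∏ f₁(xᵢ)` of `d` independent jumps with density `f₁`. -/
noncomputable def jointDensity (d : ℕ) (f₁ : ℝ → ℝ≥0) (x : Fin d → ℝ) : ℝ≥0∞ :=
  ∏ i, (f₁ (x i) : ℝ≥0∞)

/-- The zero-variance density `π(x) = 1{S(x) > γ} f(x) / ℓ`. -/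
noncomputable def zeroVarDensity {d : ℕ} (f : (Fin d → ℝ) → ℝ≥0∞) (ℓ : ℝ≥0∞) (γ : ℝ)
    (x : Fin d → ℝ) : ℝ≥0∞ :=
  (rareEvent d γ).indicator f x / ℓ

/-- The `i`-th marginal density of a density `p` on `ℝ^d`: all coordinates except the `i`-th are
integrated out, and the `i`-th one is set to `y`. -/
noncomputable def marginalDensity {d : ℕ} (p : (Fin d → ℝ) → ℝ≥0∞) (i : Fin d) (y : ℝ) : ℝ≥0∞ :=
  lmarginal (fun _ : Fin d => (volume : Measure ℝ)) (Finset.univ.erase i) p (fun _ => y)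

/-- The idealized importance sampling density `g(x) = ∏ πᵢ(xᵢ)`. -/
noncomputable def importanceDensity {d : ℕ} (f : (Fin d → ℝ) → ℝ≥0∞) (ℓ : ℝ≥0∞) (γ : ℝ)
    (x : Fin d → ℝ) : ℝ≥0∞ :=
  ∏ i, marginalDensity (zeroVarDensity f ℓ γ) i (x i)

/-- The single-run estimator `Z = 1{S(x) > γ} f(x) / g(x)`, as a function of the sample `x`. -/
noncomputable def estimator {d : ℕ} (f : (Fin d → ℝ) → ℝ≥0∞) (ℓ : ℝ≥0∞) (γ : ℝ)
    (x : Fin d → ℝ) : ℝ≥0∞ :=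
  (rareEvent d γ).indicator (fun x => f x / importanceDensity f ℓ γ x) x

/-- The second moment `E Z²` of the estimator, the sample having density `g`. -/
noncomputable def secondMoment {d : ℕ} (f : (Fin d → ℝ) → ℝ≥0∞) (ℓ : ℝ≥0∞) (γ : ℝ) : ℝ≥0∞ :=
  ∫⁻ x, estimator f ℓ γ x ^ 2 ∂(volume.withDensity (importanceDensity f ℓ γ))

/-- Logarithmic efficiency of a family of estimators of `ℓ(γ)` with second moments `m(γ)`:
`m(γ) / ℓ(γ) ^ (2 - ε) → 0` as `γ → ∞`, for every `ε > 0`. -/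
def LogEfficient (m ℓ : ℝ → ℝ≥0∞) : Prop :=
  ∀ ε : ℝ, 0 < ε → Tendsto (fun γ => m γ / ℓ γ ^ (2 - ε)) atTop (𝓝 0)

end SemiparametricCE

namespace SemiparametricCE

/-! All three classes have a tail of the form `exp (-(1 + o(1)) φ)`, where `φ` is `θ x`, `x ^ α` or
`α log (1 + x)` on `[0, ∞)`. Each such `φ` is nondecreasing, subadditive and satisfies the
Hornich–Hlawka inequality, and the argument uses nothing else about the classes.

For `d ≥ 2`, one other jump larger than `γ - y` already makes the sum exceed `γ`, so `πᵢ(y) ≥ f₁(y)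
F̄(γ - y) / ℓ`. Hence `E Z²` is at most `ℓ ^ d` times the integral of `∏ f₁(xᵢ) / F̄(γ - xᵢ)` over
the rare event. By Hlawka, the jump cost `φ(γ) - φ(γ - x) + φ(x)` is subadditive under truncation at
`γ`; since it equals `2 φ(γ)` at `x = γ`, on the rare event `∑ φ((γ - xᵢ)⁺) ≤ (d - 2) φ(γ) + ∑ φ(min
xᵢ γ)` (`TailExponent.sum_sub_le`). Up to `δ`-errors, the last sum is absorbed by the moments of
`exp ((1 - δ) φ)`, so `E Z²` is of order at most `ℓ ^ d exp ((d - 2) φ(γ))`. Markov's inequality and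
subadditivity give `ℓ ≲ exp (-(1 - δ) φ(γ))` (`rareProb_le`). Division by `ℓ ^ (2 - ε)` leaves a
factor `exp (-ε φ(γ))` up to `O(δ)` in the exponent, and `δ` is chosen small.

For `d = 1` the density `g` is `π` itself, so `E Z² ≤ ℓ²`, and it remains that `ℓ → 0`. -/

/-! ### Integrals of product functions. -/

theorem lmarginal_prod {ι : Type*} [Fintype ι] [DecidableEq ι] {E : ι → Type*}
    [∀ i, MeasurableSpace (E i)] (μ : ∀ i, Measure (E i)) [∀ i, SigmaFinite (μ i)]
    {g : ∀ i, E i → ℝ≥0∞} (hg : ∀ i, Measurable (g i)) (s : Finset ι) (x : ∀ i, E i) :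
    lmarginal μ s (fun x => ∏ i, g i (x i)) x
      = (∏ i ∈ s, ∫⁻ y, g i y ∂μ i) * ∏ i ∈ sᶜ, g i (x i) := by
  have hm : Measurable (fun x : ∀ i, E i => ∏ i, g i (x i)) :=
    Finset.measurable_fun_prod _ fun i _ => (hg i).comp (measurable_pi_apply i)
  induction s using Finset.induction_on generalizing x with
  | empty => simp
  | insert i s hi ih =>
    rw [lmarginal_insert _ hm hi]
    have hc : sᶜ = insert i (insert i s)ᶜ := by
      ext j; by_cases h : j = i <;> simp_all
    have hi' : i ∉ (insert i s)ᶜ := by simp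
    have key : ∀ y, lmarginal μ s (fun x => ∏ i, g i (x i)) (Function.update x i y)
        = ((∏ j ∈ s, ∫⁻ y, g j y ∂μ j) * ∏ j ∈ (insert i s)ᶜ, g j (x j)) * g i y := by
      intro y
      rw [ih, hc, Finset.prod_insert hi', Function.update_self]
      have : ∏ j ∈ (insert i s)ᶜ, g j (Function.update x i y j)
          = ∏ j ∈ (insert i s)ᶜ, g j (x j) :=
        Finset.prod_congr rfl fun j hj => by
          rw [Function.update_of_ne]
          rintro rfl
          exact hi' hj
      rw [this]
      ring
    simp_rw [key]
    rw [lintegral_const_mul _ (hg i), Finset.prod_insert hi]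
    ring

theorem lintegral_prod_pi {ι : Type*} [Fintype ι] {E : ι → Type*}
    [∀ i, MeasurableSpace (E i)] (μ : ∀ i, Measure (E i)) [∀ i, SigmaFinite (μ i)]
    {g : ∀ i, E i → ℝ≥0∞} (hg : ∀ i, Measurable (g i)) :
    ∫⁻ x, ∏ i, g i (x i) ∂Measure.pi μ = ∏ i, ∫⁻ y, g i y ∂μ i := by
  classical
  by_cases hE : Nonempty (∀ i, E i)
  · obtain ⟨x⟩ := hE
    rw [lintegral_eq_lmarginal_univ x, lmarginal_prod μ hg]
    simp
  · have : ∃ i, IsEmpty (E i) := by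
      by_contra! h
      exact hE ⟨fun i => (h i).some⟩
    obtain ⟨i, hi⟩ := this
    rw [not_nonempty_iff] at hE
    rw [lintegral_of_isEmpty, eq_comm]
    exact Finset.prod_eq_zero (Finset.mem_univ i) (lintegral_of_isEmpty _ _)

/-! ### Bounds on the marginals and on the likelihood ratio. -/

theorem measurableSet_rareEvent (d : ℕ) (γ : ℝ) : MeasurableSet (rareEvent d γ) :=
  measurableSet_lt measurable_const
    (Finset.measurable_fun_sum _ fun i _ => measurable_pi_apply i)

theorem measurable_jointDensity (d : ℕ) {f₁ : ℝ → ℝ≥0} (hf₁ : Measurable f₁) :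
    Measurable (jointDensity d f₁) :=
  Finset.measurable_fun_prod _ fun i _ => (hf₁.comp (measurable_pi_apply i)).coe_nnreal_ennreal

theorem measurable_marginalDensity {d : ℕ} {p : (Fin d → ℝ) → ℝ≥0∞} (hp : Measurable p)
    (i : Fin d) : Measurable (marginalDensity p i) :=
  (hp.lmarginal _).comp (measurable_pi_lambda _ fun _ => measurable_id)

theorem measurable_importanceDensity {d : ℕ} {f : (Fin d → ℝ) → ℝ≥0∞} (hf : Measurable f)
    (ℓ : ℝ≥0∞) (γ : ℝ) : Measurable (importanceDensity f ℓ γ) :=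
  Finset.measurable_fun_prod _ fun i _ =>
    (measurable_marginalDensity ((hf.indicator (measurableSet_rareEvent d γ)).div_const ℓ) i).comp
      (measurable_pi_apply i)

theorem setLIntegral_density {f₁ : ℝ → ℝ≥0} {s : Set ℝ} (hs : MeasurableSet s) :
    ∫⁻ y, s.indicator (fun y => (f₁ y : ℝ≥0∞)) y = densityLaw f₁ s := by
  rw [lintegral_indicator hs, densityLaw, withDensity_apply _ hs]

/-- A lower bound on the marginals of the zero-variance density by the tail of a single jump. -/
theorem mul_tail_div_le_marginalDensity {d : ℕ} (hd : 2 ≤ d) {f₁ : ℝ → ℝ≥0} (hf₁ : Measurable f₁)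
    (hone : densityLaw f₁ (Set.Ioi 0) = 1) (ℓ : ℝ≥0∞) (γ y : ℝ) (i : Fin d) :
    f₁ y * densityLaw f₁ (Set.Ioi (γ - y)) / ℓ
      ≤ marginalDensity (zeroVarDensity (jointDensity d f₁) ℓ γ) i y := by
  have : Nontrivial (Fin d) := Fin.nontrivial_iff_two_le.2 hd
  obtain ⟨j, hj⟩ := exists_ne i
  -- A box inside the rare event. The `i`-th side may be the null set `{y}`, because that coordinate
  -- is evaluated at `y` and not integrated.
  set t : Fin d → Set ℝ := fun k =>
    if k = i then {y} else if k = j then Set.Ioi (γ - y) else Set.Ioi 0 with ht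
  have htm : ∀ k, MeasurableSet (t k) := by
    intro k
    simp only [ht]
    split_ifs <;> measurability
  set g : Fin d → ℝ → ℝ≥0∞ := fun k => (t k).indicator fun y => (f₁ y : ℝ≥0∞) with hgdef
  have hg : ∀ k, Measurable (g k) := fun k => hf₁.coe_nnreal_ennreal.indicator (htm k)
  have hle : (fun x : Fin d → ℝ => (∏ k, g k (x k)) * ℓ⁻¹)
      ≤ zeroVarDensity (jointDensity d f₁) ℓ γ := by
    intro x
    simp only [zeroVarDensity, div_eq_mul_inv]
    gcongr
    by_cases hx : ∀ k, x k ∈ t k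
    · have hmem : x ∈ rareEvent d γ := by
        have h0 : ∀ k, k ≠ i → k ≠ j → 0 < x k := by
          intro k hk hk'
          simpa [ht, hk, hk'] using hx k
        have hi : x i = y := by simpa [ht] using hx i
        have hjj : γ - y < x j := by simpa [ht, hj] using hx j
        have : x i + x j ≤ ∑ k, x k := by
          rw [← Finset.sum_pair hj.symm]
          refine Finset.sum_le_sum_of_subset_of_nonneg (Finset.subset_univ _) ?_
          intro k _ hk
          simp only [Finset.mem_insert, Finset.mem_singleton, not_or] at hk
          exact (h0 k hk.1 hk.2).le
        simp only [rareEvent, Set.mem_ofPred_eq]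
        linarith
      rw [Set.indicator_of_mem hmem]
      exact Finset.prod_le_prod' fun k _ => Set.indicator_le_self _ _ _
    · push Not at hx
      obtain ⟨k, hk⟩ := hx
      rw [Finset.prod_eq_zero (Finset.mem_univ k)]
      · exact zero_le
      · exact Set.indicator_of_notMem hk _
  have hmul : Measurable fun x : Fin d → ℝ => ∏ k, g k (x k) :=
    Finset.measurable_fun_prod _ fun k _ => (hg k).comp (measurable_pi_apply k)
  refine le_trans ?_ (lmarginal_mono hle (fun _ => y))
  have hc : lmarginal (fun _ : Fin d => (volume : Measure ℝ)) (Finset.univ.erase i)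
      (fun x => (∏ k, g k (x k)) * ℓ⁻¹) (fun _ => y)
      = lmarginal (fun _ : Fin d => (volume : Measure ℝ)) (Finset.univ.erase i)
      (fun x => ∏ k, g k (x k)) (fun _ => y) * ℓ⁻¹ := by
    simp only [lmarginal]
    exact lintegral_mul_const _ (hmul.comp measurable_updateFinset)
  rw [hc, lmarginal_prod _ hg, div_eq_mul_inv]
  have h1 : ∏ k ∈ (Finset.univ.erase i)ᶜ, g k y = f₁ y := by
    have : (Finset.univ.erase i : Finset (Fin d))ᶜ = {i} := by ext; simp
    rw [this]
    simp [hgdef, ht]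
  have h2 : ∏ k ∈ Finset.univ.erase i, ∫⁻ y, g k y = densityLaw f₁ (Set.Ioi (γ - y)) := by
    rw [Finset.prod_eq_single_of_mem j (by simp [hj])]
    · simp only [hgdef]
      rw [setLIntegral_density (htm j)]
      simp [ht, hj]
    · intro k hk hkj
      simp only [hgdef]
      rw [setLIntegral_density (htm k)]
      have hki : k ≠ i := Finset.ne_of_mem_erase hk
      simpa [ht, hki, hkj] using hone
  rw [h1, h2, mul_comm (f₁ y : ℝ≥0∞)]

/-- A lower bound `πᵢ ≥ f₁ h / ℓ` gives `f / g ≤ ∏ ℓ / h`, and `E Z²` is at most the integral of `f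
· (f / g)` over the rare event. The function `h` is the tail at `γ - y` when `d ≥ 2` and the
constant `1` when `d = 1`. -/
theorem secondMoment_le {d : ℕ} {f₁ : ℝ → ℝ≥0} (hf₁ : Measurable f₁) {ℓ : ℝ≥0∞} (hℓ : ℓ ≠ 0)
    (hℓ' : ℓ ≠ ∞) (γ : ℝ) (h : ℝ → ℝ≥0∞) (htop : ∀ y, h y ≠ ∞)
    (h0 : ∀ x ∈ rareEvent d γ, ∀ i, h (x i) ≠ 0)
    (hle : ∀ x ∈ rareEvent d γ, ∀ i, f₁ (x i) * h (x i) / ℓ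
      ≤ marginalDensity (zeroVarDensity (jointDensity d f₁) ℓ γ) i (x i)) :
    secondMoment (jointDensity d f₁) ℓ γ ≤ ∫⁻ x, (rareEvent d γ).indicator
      (fun x => ℓ ^ d * ∏ i, f₁ (x i) * (h (x i))⁻¹) x := by
  refine (lintegral_withDensity_le_lintegral_mul _
    (measurable_importanceDensity (measurable_jointDensity d hf₁) ℓ γ) _).trans ?_
  refine lintegral_mono fun x => ?_
  by_cases hx : x ∈ rareEvent d γ
  swap
  · simp [estimator, hx]
  rw [Set.indicator_of_mem hx]
  simp only [Pi.mul_apply, estimator, Set.indicator_of_mem hx]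
  set G := importanceDensity (jointDensity d f₁) ℓ γ x
  -- Only an inequality, so `G = 0` and `G = ∞` need no separate treatment.
  have hstep : G * (jointDensity d f₁ x / G) ^ 2
      ≤ jointDensity d f₁ x * (jointDensity d f₁ x / G) := by
    rw [sq, ← mul_assoc]
    gcongr
    exact ENNReal.mul_div_le
  refine hstep.trans ?_
  have hGle : ∏ i, (f₁ (x i) * h (x i) / ℓ) ≤ G :=
    Finset.prod_le_prod' fun i _ => hle x hx i
  have hdiv : jointDensity d f₁ x / G ≤ ∏ i, ℓ * (h (x i))⁻¹ := by
    calc jointDensity d f₁ x / G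
        ≤ (∏ i, (f₁ (x i) : ℝ≥0∞)) / ∏ i, (f₁ (x i) * h (x i) / ℓ) :=
          ENNReal.div_le_div_left hGle _
      _ ≤ ∏ i, ℓ * (h (x i))⁻¹ := by
          refine ENNReal.div_le_of_le_mul ?_
          rw [← Finset.prod_mul_distrib]
          refine Finset.prod_le_prod' fun i _ => ?_
          have e : ℓ * (h (x i))⁻¹ * (f₁ (x i) * h (x i) / ℓ)
              = (ℓ * ℓ⁻¹) * ((h (x i))⁻¹ * h (x i)) * f₁ (x i) := by
            rw [div_eq_mul_inv]; ring
          rw [e, ENNReal.mul_inv_cancel hℓ hℓ', ENNReal.inv_mul_cancel (h0 x hx i) (htop _)]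
          simp
  calc jointDensity d f₁ x * (jointDensity d f₁ x / G)
      ≤ (∏ i, (f₁ (x i) : ℝ≥0∞)) * ∏ i, ℓ * (h (x i))⁻¹ := by
        unfold jointDensity at hdiv ⊢
        gcongr
    _ = _ := by
        simp only [Finset.prod_mul_distrib, Finset.prod_const, Finset.card_univ, Fintype.card_fin]
        ring

/-! ### Tail exponents and the subadditivity of the jump cost. -/

/-- Nondecreasing subadditive functions on `[0, ∞)` that satisfy the Hornich–Hlawka inequality;
the tail of the jumps is compared with `exp (-φ)` for such a function `φ`. -/
structure TailExponent (φ : ℝ → ℝ) : Prop where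
  measurable : Measurable φ
  zero : φ 0 = 0
  mono : MonotoneOn φ (Set.Ici 0)
  tendsto : Tendsto φ atTop atTop
  subadd : ∀ a b, 0 ≤ a → 0 ≤ b → φ (a + b) ≤ φ a + φ b
  hlawka : ∀ a b c, 0 ≤ a → 0 ≤ b → 0 ≤ c →
    φ (a + b) + φ (b + c) + φ (a + c) ≤ φ a + φ b + φ c + φ (a + b + c)

namespace TailExponent

variable {φ : ℝ → ℝ}

theorem sum_le (hφ : TailExponent φ) {ι : Type*} (s : Finset ι) {x : ι → ℝ} (hx : ∀ i, 0 ≤ x i) :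
    φ (∑ i ∈ s, x i) ≤ ∑ i ∈ s, φ (x i) := by
  classical
  induction s using Finset.induction_on with
  | empty => simp [hφ.zero]
  | insert i s hi ih =>
    rw [Finset.sum_insert hi, Finset.sum_insert hi]
    have := hφ.subadd (x i) (∑ j ∈ s, x j) (hx i) (Finset.sum_nonneg fun j _ => hx j)
    linarith

/-- The cost of a jump `x ∈ [0, γ]`, relative to the absence of a jump. -/
noncomputable def jumpCost (φ : ℝ → ℝ) (γ x : ℝ) : ℝ := φ γ - φ (γ - x) + φ x

/-- If `a + b ≤ γ`, this is the Hlawka inequality for `a`, `b`, `γ - a - b`. Otherwise the left side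
is `2 φ(γ)`, and the truncations `a'`, `b'` satisfy `γ - a' ≤ b'` and `γ - b' ≤ a'`, so monotonicity
suffices. -/
theorem jumpCost_add_le (hφ : TailExponent φ) {γ a b : ℝ} (hγ : 0 ≤ γ) (ha : 0 ≤ a) (hb : 0 ≤ b) :
    jumpCost φ γ (min (a + b) γ) ≤ jumpCost φ γ (min a γ) + jumpCost φ γ (min b γ) := by
  have hmono : ∀ {u v : ℝ}, 0 ≤ u → u ≤ v → φ u ≤ φ v := fun hu huv =>
    hφ.mono (Set.mem_Ici.2 hu) (Set.mem_Ici.2 (hu.trans huv)) huv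
  rcases le_total (a + b) γ with h | h
  · rw [min_eq_left h, min_eq_left (by linarith), min_eq_left (by linarith)]
    have := hφ.hlawka a b (γ - a - b) ha hb (by linarith)
    have e1 : b + (γ - a - b) = γ - a := by ring
    have e2 : a + (γ - a - b) = γ - b := by ring
    have e3 : a + b + (γ - a - b) = γ := by ring
    rw [e1, e2, e3] at this
    simp only [jumpCost, ← sub_sub]
    linarith
  · rw [min_eq_right h]
    have ha' : 0 ≤ min a γ := le_min ha hγ
    have hb' : 0 ≤ min b γ := le_min hb hγ
    have hsum : γ ≤ min a γ + min b γ := by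
      rcases le_total a γ with h1 | h1 <;> rcases le_total b γ with h2 | h2 <;>
        simp only [h1, h2, min_eq_left, min_eq_right] <;> linarith
    have h1 := hmono (u := γ - min a γ) (v := min b γ) (by simp) (by linarith)
    have h2 := hmono (u := γ - min b γ) (v := min a γ) (by simp) (by linarith)
    simp only [jumpCost, sub_self, hφ.zero]
    linarith

theorem jumpCost_sum_le (hφ : TailExponent φ) {ι : Type*} (s : Finset ι) {x : ι → ℝ}
    (hx : ∀ i, 0 ≤ x i) {γ : ℝ} (hγ : 0 ≤ γ) :
    jumpCost φ γ (min (∑ i ∈ s, x i) γ) ≤ ∑ i ∈ s, jumpCost φ γ (min (x i) γ) := by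
  classical
  induction s using Finset.induction_on with
  | empty => simp [jumpCost, hφ.zero, hγ]
  | insert i s hi ih =>
    rw [Finset.sum_insert hi, Finset.sum_insert hi]
    have := hφ.jumpCost_add_le hγ (hx i) (Finset.sum_nonneg fun j (_ : j ∈ s) => hx j)
    linarith

theorem sum_sub_le (hφ : TailExponent φ) {d : ℕ} {x : Fin d → ℝ} (hx : ∀ i, 0 ≤ x i) {γ : ℝ}
    (hγ : 0 ≤ γ) (hsum : γ ≤ ∑ i, x i) :
    ∑ i, φ (max (γ - x i) 0) ≤ (d - 2) * φ γ + ∑ i, φ (min (x i) γ) := by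
  have h := hφ.jumpCost_sum_le Finset.univ hx hγ
  rw [min_eq_right hsum] at h
  have e : ∀ i, max (γ - x i) 0 = γ - min (x i) γ := by
    intro i
    rcases le_total (x i) γ with h | h
    · rw [min_eq_left h, max_eq_left (by linarith)]
    · rw [min_eq_right h, max_eq_right (by linarith), sub_self]
  simp only [jumpCost, Finset.sum_add_distrib, Finset.sum_sub_distrib, Finset.sum_const,
    Finset.card_univ, Fintype.card_fin, nsmul_eq_mul, sub_self, hφ.zero] at h
  simp_rw [e]
  linarith

/-- Splits `1 + δ = 2δ + (1 - δ)`: the part of order `1 - δ` has a finite exponential moment, the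
excess is charged to `φ(γ)`. -/
theorem min_le (hφ : TailExponent φ) {δ : ℝ} (hδ : 0 ≤ δ) (hδ1 : δ ≤ 1) {x γ : ℝ} (hx : 0 ≤ x)
    (hγ : 0 ≤ γ) :
    (1 + δ) * φ (min x γ) ≤ 2 * δ * φ γ + (1 - δ) * φ x := by
  have h1 : φ (min x γ) ≤ φ γ := hφ.mono (le_min hx hγ) hγ (min_le_right _ _)
  have h2 : φ (min x γ) ≤ φ x := hφ.mono (le_min hx hγ) hx (min_le_left _ _)
  nlinarith

theorem const_mul (hφ : TailExponent φ) {c : ℝ} (hc : 0 < c) :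
    TailExponent fun x => c * φ x where
  measurable := hφ.measurable.const_mul c
  zero := by simp [hφ.zero]
  mono _ hx _ hy hxy := mul_le_mul_of_nonneg_left (hφ.mono hx hy hxy) hc.le
  tendsto := hφ.tendsto.const_mul_atTop hc
  subadd a b ha hb := by nlinarith [hφ.subadd a b ha hb]
  hlawka a b c ha hb hc := by nlinarith [hφ.hlawka a b c ha hb hc]

theorem id : TailExponent fun x => x where
  measurable := measurable_id
  zero := rfl
  mono _ _ _ _ h := h
  tendsto := tendsto_id
  subadd _ _ _ _ := le_rfl
  hlawka a b c _ _ _ := by linarith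

theorem log_one_add : TailExponent fun x => Real.log (1 + max x 0) where
  measurable := by fun_prop
  zero := by simp
  mono x hx y hy h := by
    have : (0 : ℝ) ≤ x := hx
    have : (0 : ℝ) ≤ y := hy
    dsimp only
    gcongr
  tendsto := Real.tendsto_log_atTop.comp (tendsto_atTop_add_const_left _ _
    (tendsto_atTop_mono (fun x => le_max_left x 0) tendsto_id))
  subadd a b ha hb := by
    rw [max_eq_left ha, max_eq_left hb, max_eq_left (add_nonneg ha hb),
      ← Real.log_mul (by positivity) (by positivity)]
    apply Real.log_le_log (by positivity)
    nlinarith [mul_nonneg ha hb]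
  hlawka a b c ha hb hc := by
    have := mul_nonneg ha hb
    rw [max_eq_left ha, max_eq_left hb, max_eq_left hc, max_eq_left (add_nonneg ha hb),
      max_eq_left (add_nonneg hb hc), max_eq_left (add_nonneg ha hc),
      max_eq_left (by positivity : 0 ≤ a + b + c),
      ← Real.log_mul (by positivity) (by positivity), ← Real.log_mul (by positivity) (by positivity),
      ← Real.log_mul (by positivity) (by positivity), ← Real.log_mul (by positivity) (by positivity),
      ← Real.log_mul (by positivity) (by positivity)]
    apply Real.log_le_log (by positivity)
    have h3 : 0 ≤ a * b * c := by positivity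
    have h4 : 0 ≤ a * b * c * (a + b + c) := by positivity
    -- The right side minus the left side equals `a b c (2 + a + b + c)`.
    nlinarith

/-- Convexity of `x ↦ x ^ p` for `p ≤ 0`, in the form of an inequality between opposite pairs
of points. -/
theorem rpow_opposite_le {p a b c : ℝ} (hp : p ≤ 0) (hc : 0 < c) (ha : 0 ≤ a) (hb : 0 ≤ b) :
    (c + a) ^ p + (c + b) ^ p ≤ c ^ p + (c + a + b) ^ p := by
  have hanti : AntitoneOn (fun t : ℝ => t ^ p - (t + b) ^ p) (Set.Ici c) := by
    have hd : ∀ t : ℝ, 0 < t → HasDerivAt (fun t : ℝ => t ^ p - (t + b) ^ p)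
        (p * t ^ (p - 1) - p * (t + b) ^ (p - 1)) t := by
      intro t ht
      have h1 := Real.hasDerivAt_rpow_const (x := t) (p := p) (Or.inl ht.ne')
      have h2 := Real.hasDerivAt_rpow_const (x := t + b) (p := p) (Or.inl (by positivity))
      exact h1.sub (by simpa using h2.comp_add_const t b)
    refine antitoneOn_of_deriv_nonpos (convex_Ici c) ?_ ?_ ?_
    · intro t ht
      exact (hd t (hc.trans_le ht)).continuousAt.continuousWithinAt
    · intro t ht
      rw [interior_Ici] at ht
      exact (hd t (hc.trans ht)).differentiableAt.differentiableWithinAt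
    · intro t ht
      rw [interior_Ici] at ht
      have ht0 : 0 < t := hc.trans ht
      rw [(hd t ht0).deriv]
      have : (t + b) ^ (p - 1) ≤ t ^ (p - 1) :=
        Real.rpow_le_rpow_of_nonpos ht0 (by linarith) (by linarith)
      nlinarith
  have := hanti (Set.mem_Ici.2 le_rfl) (Set.mem_Ici.2 (by linarith : c ≤ c + a)) (by linarith)
  dsimp only at this
  linarith

/-- The second difference `t ^ α + (t + a + b) ^ α - (t + a) ^ α - (t + b) ^ α` is nondecreasing in
`t`, since its derivative is a second difference of the convex `t ^ (α - 1)`; compare `t = 0` with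
`t = c`. -/
theorem rpow_hlawka {α a b c : ℝ} (hα : 0 < α) (hα1 : α < 1) (ha : 0 ≤ a) (hb : 0 ≤ b)
    (hc : 0 ≤ c) :
    (a + b) ^ α + (b + c) ^ α + (a + c) ^ α ≤ a ^ α + b ^ α + c ^ α + (a + b + c) ^ α := by
  have hd : ∀ t : ℝ, 0 < t →
      HasDerivAt (fun t : ℝ => t ^ α + (t + (a + b)) ^ α - ((t + a) ^ α + (t + b) ^ α))
      (α * t ^ (α - 1) + α * (t + (a + b)) ^ (α - 1)
        - (α * (t + a) ^ (α - 1) + α * (t + b) ^ (α - 1))) t := by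
    intro t ht
    have h : ∀ s : ℝ, 0 ≤ s → HasDerivAt (fun t : ℝ => (t + s) ^ α) (α * (t + s) ^ (α - 1)) t := by
      intro s hs
      have h2 := Real.hasDerivAt_rpow_const (x := t + s) (p := α) (Or.inl (by positivity))
      exact h2.comp_add_const t s
    exact ((by simpa using h 0 le_rfl : HasDerivAt (fun t : ℝ => t ^ α) (α * t ^ (α - 1)) t).add
      (h _ (by positivity))).sub ((h a ha).add (h b hb))
  have hmono : MonotoneOn (fun t : ℝ => t ^ α + (t + (a + b)) ^ α - ((t + a) ^ α + (t + b) ^ α))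
      (Set.Ici 0) := by
    refine monotoneOn_of_deriv_nonneg (convex_Ici 0) ?_ ?_ ?_
    · have hcont : ∀ s : ℝ, Continuous fun t : ℝ => (t + s) ^ α := fun s =>
        (continuous_id.add continuous_const).rpow_const fun _ => Or.inr hα.le
      have h0 : Continuous fun t : ℝ => t ^ α := continuous_id.rpow_const fun _ => Or.inr hα.le
      exact ((h0.add (hcont _)).sub ((hcont a).add (hcont b))).continuousOn
    · intro t ht
      rw [interior_Ici] at ht
      exact (hd t ht).differentiableAt.differentiableWithinAt
    · intro t ht
      rw [interior_Ici] at ht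
      rw [(hd t ht).deriv]
      have := rpow_opposite_le (p := α - 1) (by linarith) ht ha hb
      rw [add_assoc] at this
      nlinarith
  have h := hmono (Set.mem_Ici.2 le_rfl) (Set.mem_Ici.2 hc) hc
  simp only [zero_add, Real.zero_rpow hα.ne'] at h
  rw [add_comm b c, add_comm a c, add_comm (a + b) c]
  linarith

theorem rpow {α : ℝ} (hα : 0 < α) (hα1 : α < 1) : TailExponent fun x => x ^ α where
  measurable := by fun_prop
  zero := Real.zero_rpow hα.ne'
  mono _ hx _ _ h := Real.rpow_le_rpow hx h hα.le
  tendsto := tendsto_rpow_atTop hα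
  subadd _ _ ha hb := Real.rpow_add_le_add_rpow ha hb hα.le hα1.le
  hlawka _ _ _ ha hb hc := rpow_hlawka hα hα1 ha hb hc

end TailExponent

/-! ### Exponential bounds on `ℓ` and on the second moment. -/

theorem measurable_prod_apply (d : ℕ) {g : ℝ → ℝ≥0∞} (hg : Measurable g) :
    Measurable fun x : Fin d → ℝ => ∏ i, g (x i) :=
  Finset.measurable_fun_prod _ fun i _ => hg.comp (measurable_pi_apply i)

theorem lintegral_prod_density (d : ℕ) {f₁ : ℝ → ℝ≥0} (hf₁ : Measurable f₁) {u : ℝ → ℝ≥0∞}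
    (hu : Measurable u) :
    ∫⁻ x : Fin d → ℝ, ∏ i, f₁ (x i) * u (x i) = (∫⁻ y, u y ∂densityLaw f₁) ^ d := by
  rw [volume_pi, lintegral_prod_pi (fun _ => volume) (g := fun _ y => f₁ y * u y)
    fun _ => hf₁.coe_nnreal_ennreal.mul hu]
  rw [Finset.prod_const, Finset.card_univ, Fintype.card_fin, densityLaw,
    lintegral_withDensity_eq_lintegral_mul _ hf₁.coe_nnreal_ennreal hu]
  rfl

/-- The second moment is bounded by a Lebesgue integral, where positivity of the jumps is available
only off the zeros of the joint density; at those zeros the integrand vanishes. -/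
theorem ae_pos_or_density_eq_zero (d : ℕ) {f₁ : ℝ → ℝ≥0} (hf₁ : Measurable f₁)
    (hpos : densityLaw f₁ (Set.Iic 0) = 0) :
    ∀ᵐ x : Fin d → ℝ, (∀ i, 0 < x i) ∨ ∃ i, f₁ (x i) = 0 := by
  have h1 : ∀ᵐ y : ℝ, 0 < y ∨ f₁ y = 0 := by
    rw [densityLaw, withDensity_apply _ measurableSet_Iic,
      lintegral_eq_zero_iff hf₁.coe_nnreal_ennreal, EventuallyEq,
      ae_restrict_iff' measurableSet_Iic] at hpos
    filter_upwards [hpos] with y hy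
    rcases lt_or_ge 0 y with h | h
    · exact Or.inl h
    · exact Or.inr (by simpa using hy h)
  rw [volume_pi]
  have h2 : ∀ᵐ x ∂Measure.pi fun _ : Fin d => (volume : Measure ℝ), ∀ i, 0 < x i ∨ f₁ (x i) = 0 :=
    ae_all_iff.2 fun i =>
      (Measure.tendsto_eval_ae_ae (μ := fun _ : Fin d => (volume : Measure ℝ)) (i := i)).eventually h1
  filter_upwards [h2] with x hx
  by_contra! h
  obtain ⟨⟨i, hi⟩, h⟩ := h
  rcases hx i with h' | h'
  · exact absurd h' (not_lt.2 hi)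
  · exact h i h'

section RareProb

variable {Ω : Type*} [MeasurableSpace Ω] {P : Measure Ω}
  {d : ℕ} {X : Fin d → Ω → ℝ} {μ : Measure ℝ}

theorem rareProb_eq_pi (hlaw : ∀ i, HasLaw (X i) μ P) (hindep : iIndepFun X P) (γ : ℝ) :
    rareProb P X γ = Measure.pi (fun _ : Fin d => μ) (rareEvent d γ) := by
  have h := hindep.hasLaw_pi hlaw
  rw [← h.map_eq, Measure.map_apply_of_aemeasurable h.aemeasurable (measurableSet_rareEvent d γ)]
  rfl

theorem rareProb_ne_zero [SigmaFinite μ] (hd : 0 < d) (hlaw : ∀ i, HasLaw (X i) μ P)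
    (hindep : iIndepFun X P) (hunbdd : ∀ x : ℝ, 0 < μ (Set.Ioi x)) (γ : ℝ) :
    rareProb P X γ ≠ 0 := by
  rw [rareProb_eq_pi hlaw hindep]
  have hsub : (Set.univ.pi fun _ : Fin d => Set.Ioi (max γ 0)) ⊆ rareEvent d γ := by
    intro x hx
    have hx' : ∀ i, max γ 0 < x i := fun i => hx i (Set.mem_univ i)
    have h0 : ∀ i, 0 < x i := fun i => (le_max_right _ _).trans_lt (hx' i)
    calc γ ≤ max γ 0 := le_max_left _ _
      _ < x ⟨0, hd⟩ := hx' _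
      _ ≤ ∑ i, x i := Finset.single_le_sum (fun i _ => (h0 i).le) (Finset.mem_univ _)
  refine (lt_of_lt_of_le ?_ (measure_mono hsub)).ne'
  rw [Measure.pi_pi]
  exact pos_iff_ne_zero.2 (Finset.prod_ne_zero_iff.2 fun _ _ => (hunbdd _).ne')

/-- Markov's inequality: on the rare event `φ(γ) ≤ φ(S) ≤ ∑ φ(xᵢ)`, and the exponential of the sum
factorizes by independence. -/
theorem rareProb_le {φ : ℝ → ℝ} (hφ : TailExponent φ) [SigmaFinite μ]
    (hlaw : ∀ i, HasLaw (X i) μ P) (hindep : iIndepFun X P) (hpos : μ (Set.Iic 0) = 0)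
    {γ : ℝ} (hγ : 0 ≤ γ) {p : ℝ} (hp : 0 ≤ p) :
    rareProb P X γ ≤ (∫⁻ y, ENNReal.ofReal (Real.exp (p * φ y)) ∂μ) ^ d
      * ENNReal.ofReal (Real.exp (-(p * φ γ))) := by
  have hm : Measurable fun y => ENNReal.ofReal (Real.exp (p * φ y)) := by
    have := hφ.measurable
    fun_prop
  have hpos' : ∀ᵐ x ∂Measure.pi (fun _ : Fin d => μ), ∀ i, 0 < x i := by
    refine ae_all_iff.2 fun i => (Measure.tendsto_eval_ae_ae (i := i)).eventually ?_
    simpa [ae_iff, Set.Iic] using hpos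
  rw [rareProb_eq_pi hlaw hindep, ← lintegral_indicator_one (measurableSet_rareEvent d γ)]
  calc ∫⁻ x, (rareEvent d γ).indicator 1 x ∂Measure.pi (fun _ : Fin d => μ)
      ≤ ∫⁻ x, (∏ i, ENNReal.ofReal (Real.exp (p * φ (x i))))
          * ENNReal.ofReal (Real.exp (-(p * φ γ))) ∂Measure.pi (fun _ : Fin d => μ) := by
        refine lintegral_mono_ae ?_
        filter_upwards [hpos'] with x hx
        by_cases hx' : x ∈ rareEvent d γ
        swap
        · simp [hx']
        rw [Set.indicator_of_mem hx', ← ENNReal.ofReal_prod_of_nonneg fun i _ => (Real.exp_pos _).le,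
          ← ENNReal.ofReal_mul (Finset.prod_nonneg fun i _ => (Real.exp_pos _).le),
          ← Real.exp_sum, ← Real.exp_add, ← Finset.mul_sum]
        simp only [Pi.one_apply]
        rw [ENNReal.one_le_ofReal]
        apply Real.one_le_exp
        have h1 : φ γ ≤ φ (∑ i, x i) :=
          hφ.mono hγ (Set.mem_Ici.2 (hγ.trans (le_of_lt hx'))) (le_of_lt hx')
        have h2 := hφ.sum_le Finset.univ fun i => (hx i).le
        nlinarith
    _ = _ := by
        rw [lintegral_mul_const, lintegral_prod_pi _ fun _ => hm]
        · simp
        · exact measurable_prod_apply d hm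

end RareProb

theorem secondMoment_le_of_tail_le {d : ℕ} (hd : 2 ≤ d) {f₁ : ℝ → ℝ≥0} (hf₁ : Measurable f₁)
    [IsProbabilityMeasure (densityLaw f₁)]
    (hpos : densityLaw f₁ (Set.Iic 0) = 0) (hunbdd : ∀ x : ℝ, 0 < densityLaw f₁ (Set.Ioi x))
    {φ : ℝ → ℝ} (hφ : TailExponent φ) {δ C : ℝ} (hδ : 0 ≤ δ) (hδ1 : δ ≤ 1) (hC : 0 ≤ C)
    (hlow : ∀ y, 0 ≤ y →
      (densityLaw f₁ (Set.Ioi y))⁻¹ ≤ ENNReal.ofReal (C * Real.exp ((1 + δ) * φ y)))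
    {ℓ : ℝ≥0∞} (hℓ : ℓ ≠ 0) (hℓ' : ℓ ≠ ∞) {γ : ℝ} (hγ : 0 ≤ γ) :
    secondMoment (jointDensity d f₁) ℓ γ ≤ ℓ ^ d *
      (ENNReal.ofReal (C ^ d * Real.exp (((1 + δ) * (d - 2) + 2 * δ * d) * φ γ)) *
      (∫⁻ y, ENNReal.ofReal (Real.exp ((1 - δ) * φ y)) ∂densityLaw f₁) ^ d) := by
  have hm : Measurable fun y => ENNReal.ofReal (Real.exp ((1 - δ) * φ y)) := by
    have := hφ.measurable
    fun_prop
  have hmd : Measurable fun x : Fin d → ℝ =>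
      ∏ i, f₁ (x i) * ENNReal.ofReal (Real.exp ((1 - δ) * φ (x i))) :=
    measurable_prod_apply d (hf₁.coe_nnreal_ennreal.mul hm)
  have hone : densityLaw f₁ (Set.Ioi 0) = 1 := by
    rw [← Set.compl_Iic, prob_compl_eq_one_iff measurableSet_Iic]
    exact hpos
  refine (secondMoment_le hf₁ hℓ hℓ' γ (fun y => densityLaw f₁ (Set.Ioi (γ - y)))
    (fun y => measure_ne_top _ _) (fun x _ i => (hunbdd _).ne')
    (fun x _ i => mul_tail_div_le_marginalDensity hd hf₁ hone ℓ γ (x i) i)).trans ?_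
  rw [← lintegral_prod_density d hf₁ hm, ← lintegral_const_mul, ← lintegral_const_mul]
  rotate_left
  · exact hmd.const_mul _
  · exact hmd
  refine lintegral_mono_ae ?_
  filter_upwards [ae_pos_or_density_eq_zero d hf₁ hpos] with x hx
  by_cases hx' : x ∈ rareEvent d γ
  swap
  · simp [hx']
  rw [Set.indicator_of_mem hx']
  rcases hx with hx | ⟨i, hi⟩
  swap
  · rw [Finset.prod_eq_zero (Finset.mem_univ i) (by simp [hi])]
    simp
  gcongr
  rw [Finset.prod_mul_distrib, Finset.prod_mul_distrib, mul_left_comm]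
  gcongr
  -- A jump may exceed `γ`; the tail bound needs a nonnegative argument, and raising it to `0` only
  -- shrinks the tail.
  have htail : ∀ i, (densityLaw f₁ (Set.Ioi (γ - x i)))⁻¹
      ≤ ENNReal.ofReal (C * Real.exp ((1 + δ) * φ (max (γ - x i) 0))) := fun i =>
    (ENNReal.inv_le_inv.2 (measure_mono (Set.Ioi_subset_Ioi (le_max_left _ _)))).trans
      (hlow _ (le_max_right _ _))
  refine (Finset.prod_le_prod' fun i _ => htail i).trans ?_
  rw [← ENNReal.ofReal_prod_of_nonneg fun i _ => by positivity,
    ← ENNReal.ofReal_prod_of_nonneg fun i _ => by positivity,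
    ← ENNReal.ofReal_mul (by positivity), Finset.prod_mul_distrib, Finset.prod_const,
    Finset.card_univ, Fintype.card_fin, mul_assoc, ← Real.exp_sum, ← Real.exp_sum, ← Real.exp_add,
    ← Finset.mul_sum]
  gcongr
  have h1 := hφ.sum_sub_le (fun i => (hx i).le) hγ (le_of_lt hx')
  have h2 : ∑ i, (1 + δ) * φ (min (x i) γ) ≤ ∑ i, (2 * δ * φ γ + (1 - δ) * φ (x i)) :=
    Finset.sum_le_sum fun i _ => hφ.min_le hδ hδ1 (hx i).le hγ
  rw [Finset.sum_add_distrib, ← Finset.mul_sum, Finset.sum_const, Finset.card_univ,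
    Fintype.card_fin, nsmul_eq_mul] at h2
  have h3 := mul_le_mul_of_nonneg_left h1 (by linarith : 0 ≤ 1 + δ)
  linarith

/-- With a single coordinate nothing is integrated out: `π` is its own marginal, so `h = 1` is
admissible. -/
theorem secondMoment_one_le {f₁ : ℝ → ℝ≥0} (hf₁ : Measurable f₁) {ℓ : ℝ≥0∞} (hℓ : ℓ ≠ 0)
    (hℓ' : ℓ ≠ ∞) (γ : ℝ) :
    secondMoment (jointDensity 1 f₁) ℓ γ ≤ ℓ * densityLaw f₁ (Set.Ioi γ) := by
  refine (secondMoment_le hf₁ hℓ hℓ' γ (fun _ => 1) (by simp) (by simp) ?_).trans ?_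
  · intro x hx i
    have hx' : (fun _ : Fin 1 => x 0) ∈ rareEvent 1 γ := by simpa [rareEvent] using hx
    fin_cases i
    simp [marginalDensity, zeroVarDensity, hx', jointDensity]
  · have : ∀ x : Fin 1 → ℝ, (rareEvent 1 γ).indicator
        (fun x => ℓ ^ 1 * ∏ i, (f₁ (x i) : ℝ≥0∞) * 1⁻¹) x
        = ℓ * ∏ i, (Set.Ioi γ).indicator (fun y => (f₁ y : ℝ≥0∞)) (x i) := by
      intro x
      by_cases hx : γ < x 0
      · rw [Set.indicator_of_mem (by simpa [rareEvent] using hx)]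
        simp [hx]
      · rw [Set.indicator_of_notMem (by simpa [rareEvent] using hx)]
        simp [hx]
    simp_rw [this]
    have hm : Measurable ((Set.Ioi γ).indicator (fun y => (f₁ y : ℝ≥0∞))) :=
      hf₁.coe_nnreal_ennreal.indicator measurableSet_Ioi
    rw [lintegral_const_mul _ (measurable_prod_apply 1 hm), volume_pi, lintegral_prod_pi _ fun _ => hm]
    simp [setLIntegral_density measurableSet_Ioi]

/-! ### Logarithmic efficiency from a tail exponent. -/

/-- The tail of `μ` is `exp (-(1 + o(1)) φ)`: a lower bound on the tail, and exponential moments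
of `φ` of every order less than one. -/
structure HasTailExponent (φ : ℝ → ℝ) (μ : Measure ℝ) : Prop where
  lower : ∀ δ : ℝ, 0 < δ → ∃ C : ℝ, 0 ≤ C ∧ ∀ y, 0 ≤ y →
    (μ (Set.Ioi y))⁻¹ ≤ ENNReal.ofReal (C * Real.exp ((1 + δ) * φ y))
  upper : ∀ δ : ℝ, 0 < δ → δ < 1 → ∫⁻ y, ENNReal.ofReal (Real.exp ((1 - δ) * φ y)) ∂μ ≠ ∞

theorem TailExponent.tendsto_const_mul_exp_neg {φ : ℝ → ℝ} (hφ : TailExponent φ) {K : ℝ≥0∞}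
    (hK : K ≠ ∞) {c : ℝ} (hc : 0 < c) :
    Tendsto (fun γ => K * ENNReal.ofReal (Real.exp (-(c * φ γ)))) atTop (𝓝 0) := by
  have h1 : Tendsto (fun γ => Real.exp (-(c * φ γ))) atTop (𝓝 0) :=
    Real.tendsto_exp_neg_atTop_nhds_zero.comp (hφ.tendsto.const_mul_atTop hc)
  have h2 := ENNReal.Tendsto.const_mul (a := K) (ENNReal.tendsto_ofReal h1) (Or.inr hK)
  simpa using h2

section

variable {Ω : Type*} [MeasurableSpace Ω] {P : Measure Ω} [IsProbabilityMeasure P]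
  {d : ℕ} {X : Fin d → Ω → ℝ} {f₁ : ℝ → ℝ≥0} {φ : ℝ → ℝ}

/-- As `d ≥ 2`, the power `d - 2 + ε` of `ℓ` is positive and the upper bound on `ℓ` applies. The
decay rate is `(1 - δ)(d - 2 + ε) - (1 + δ)(d - 2) - 2δd = ε - δ(4d - 4 + ε)`. -/
theorem secondMoment_div_le (hd : 2 ≤ d) (hf₁ : Measurable f₁)
    [IsProbabilityMeasure (densityLaw f₁)] (hlaw : ∀ i, HasLaw (X i) (densityLaw f₁) P)
    (hindep : iIndepFun X P) (hpos : densityLaw f₁ (Set.Iic 0) = 0)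
    (hunbdd : ∀ x : ℝ, 0 < densityLaw f₁ (Set.Ioi x)) (hφ : TailExponent φ)
    {δ C ε : ℝ} (hδ : 0 ≤ δ) (hδ1 : δ ≤ 1) (hC : 0 ≤ C) (hε : 0 < ε)
    (hlow : ∀ y, 0 ≤ y →
      (densityLaw f₁ (Set.Ioi y))⁻¹ ≤ ENNReal.ofReal (C * Real.exp ((1 + δ) * φ y)))
    {M : ℝ≥0∞} (hM : ∫⁻ y, ENNReal.ofReal (Real.exp ((1 - δ) * φ y)) ∂densityLaw f₁ = M)
    {γ : ℝ} (hγ : 0 ≤ γ) :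
    secondMoment (jointDensity d f₁) (rareProb P X γ) γ / rareProb P X γ ^ (2 - ε)
      ≤ (M ^ d) ^ ((d : ℝ) - (2 - ε)) * (ENNReal.ofReal (C ^ d) * M ^ d) *
        ENNReal.ofReal (Real.exp (-((ε - δ * (4 * d - 4 + ε)) * φ γ))) := by
  have hℓ : rareProb P X γ ≠ 0 := rareProb_ne_zero (by omega) hlaw hindep hunbdd γ
  have hℓ' : rareProb P X γ ≠ ∞ := measure_ne_top _ _
  have h1 := secondMoment_le_of_tail_le hd hf₁ hpos hunbdd hφ hδ hδ1 hC hlow hℓ hℓ' hγ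
  have h2 := rareProb_le hφ hlaw hindep hpos hγ (p := 1 - δ) (by linarith)
  rw [hM] at h1 h2
  set ℓ := rareProb P X γ
  have hd' : (2 : ℝ) ≤ d := by exact_mod_cast hd
  have hq : 0 ≤ (d : ℝ) - (2 - ε) := by linarith
  calc secondMoment (jointDensity d f₁) ℓ γ / ℓ ^ (2 - ε)
      ≤ ℓ ^ d * (ENNReal.ofReal
          (C ^ d * Real.exp (((1 + δ) * (d - 2) + 2 * δ * d) * φ γ)) * M ^ d) / ℓ ^ (2 - ε) := by
        gcongr
    _ = ℓ ^ ((d : ℝ) - (2 - ε)) * (ENNReal.ofReal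
          (C ^ d * Real.exp (((1 + δ) * (d - 2) + 2 * δ * d) * φ γ)) * M ^ d) := by
        rw [ENNReal.rpow_sub (d : ℝ) (2 - ε) hℓ hℓ', ENNReal.rpow_natCast, div_eq_mul_inv,
          div_eq_mul_inv]
        ring
    _ ≤ (M ^ d * ENNReal.ofReal (Real.exp (-((1 - δ) * φ γ)))) ^ ((d : ℝ) - (2 - ε)) *
          (ENNReal.ofReal (C ^ d * Real.exp (((1 + δ) * (d - 2) + 2 * δ * d) * φ γ)) * M ^ d) := by
        gcongr
    _ = (M ^ d) ^ ((d : ℝ) - (2 - ε)) * (ENNReal.ofReal (C ^ d) * M ^ d) *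
          (ENNReal.ofReal (Real.exp (-((1 - δ) * φ γ) * ((d : ℝ) - (2 - ε)))) *
          ENNReal.ofReal (Real.exp (((1 + δ) * (d - 2) + 2 * δ * d) * φ γ))) := by
        rw [ENNReal.mul_rpow_of_nonneg _ _ hq, ENNReal.ofReal_rpow_of_pos (Real.exp_pos _),
          ← Real.exp_mul, ENNReal.ofReal_mul (by positivity)]
        ring
    _ = _ := by
        rw [← ENNReal.ofReal_mul (Real.exp_pos _).le, ← Real.exp_add]
        congr 3
        ring

theorem logEfficient_of_two_le (hd : 2 ≤ d) (hf₁ : Measurable f₁)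
    [IsProbabilityMeasure (densityLaw f₁)] (hlaw : ∀ i, HasLaw (X i) (densityLaw f₁) P)
    (hindep : iIndepFun X P) (hpos : densityLaw f₁ (Set.Iic 0) = 0)
    (hunbdd : ∀ x : ℝ, 0 < densityLaw f₁ (Set.Ioi x)) (hφ : TailExponent φ)
    (htail : HasTailExponent φ (densityLaw f₁)) :
    LogEfficient (fun γ => secondMoment (jointDensity d f₁) (rareProb P X γ) γ)
      (fun γ => rareProb P X γ) := by
  intro ε hε
  have hd' : (2 : ℝ) ≤ d := by exact_mod_cast hd
  obtain ⟨δ, hδ, hδ1, hc⟩ : ∃ δ : ℝ, 0 < δ ∧ δ < 1 ∧ 0 < ε - δ * (4 * d - 4 + ε) := by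
    have hD : 0 < 4 * (d : ℝ) - 4 + ε := by linarith
    -- This `δ` leaves the decay rate `ε / 2`.
    refine ⟨ε / (2 * (4 * d - 4 + ε)), by positivity, ?_, ?_⟩
    · rw [div_lt_one (by positivity)]
      linarith
    · have : ε / (2 * (4 * d - 4 + ε)) * (4 * d - 4 + ε) = ε / 2 := by
        rw [div_mul_eq_mul_div, mul_div_mul_right _ _ hD.ne']
      rw [this]
      linarith
  obtain ⟨C, hC, hlow⟩ := htail.lower δ hδ
  have hM := htail.upper δ hδ hδ1
  refine tendsto_of_tendsto_of_tendsto_of_le_of_le' tendsto_const_nhds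
    (hφ.tendsto_const_mul_exp_neg ?_ hc) (Eventually.of_forall fun _ => zero_le)
    ((eventually_ge_atTop 0).mono fun γ hγ => secondMoment_div_le hd hf₁ hlaw hindep hpos hunbdd
      hφ hδ.le hδ1.le hC hε hlow rfl hγ)
  have hMd := ENNReal.pow_ne_top (n := d) hM
  exact ENNReal.mul_ne_top (ENNReal.rpow_ne_top_of_nonneg (by linarith) hMd)
    (ENNReal.mul_ne_top ENNReal.ofReal_ne_top hMd)

theorem logEfficient_of_eq_one {X : Fin 1 → Ω → ℝ} (hf₁ : Measurable f₁)
    [IsProbabilityMeasure (densityLaw f₁)] (hlaw : ∀ i, HasLaw (X i) (densityLaw f₁) P)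
    (hindep : iIndepFun X P) (hpos : densityLaw f₁ (Set.Iic 0) = 0)
    (hunbdd : ∀ x : ℝ, 0 < densityLaw f₁ (Set.Ioi x)) (hφ : TailExponent φ)
    (htail : HasTailExponent φ (densityLaw f₁)) :
    LogEfficient (fun γ => secondMoment (jointDensity 1 f₁) (rareProb P X γ) γ)
      (fun γ => rareProb P X γ) := by
  intro ε hε
  -- Only `ℓ → 0` is needed, so any `δ` in `(0, 1)` would do.
  have hM := htail.upper (1 / 2) (by norm_num) (by norm_num)
  set M := ∫⁻ y, ENNReal.ofReal (Real.exp ((1 - 1 / 2) * φ y)) ∂densityLaw f₁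
  have hc : 0 < 1 / 2 * ε := by positivity
  refine tendsto_of_tendsto_of_tendsto_of_le_of_le' tendsto_const_nhds
    (hφ.tendsto_const_mul_exp_neg (K := M ^ ε) (ENNReal.rpow_ne_top_of_nonneg hε.le hM) hc)
    (Eventually.of_forall fun _ => zero_le) ((eventually_ge_atTop 0).mono fun γ hγ => ?_)
  have hℓ : rareProb P X γ ≠ 0 := rareProb_ne_zero one_pos hlaw hindep hunbdd γ
  have hℓ' : rareProb P X γ ≠ ∞ := measure_ne_top _ _
  have h1 := secondMoment_one_le hf₁ hℓ hℓ' γ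
  have h2 := rareProb_le hφ hlaw hindep hpos hγ (p := 1 - 1 / 2) (by norm_num)
  have h3 : densityLaw f₁ (Set.Ioi γ) = rareProb P X γ := by
    rw [← (hlaw 0).map_eq, Measure.map_apply_of_aemeasurable (hlaw 0).aemeasurable
      measurableSet_Ioi]
    simp [rareProb, rareEvent, Set.preimage]
  rw [h3] at h1
  rw [pow_one] at h2
  set ℓ := rareProb P X γ
  calc secondMoment (jointDensity 1 f₁) ℓ γ / ℓ ^ (2 - ε)
      ≤ ℓ * ℓ / ℓ ^ (2 - ε) := by gcongr
    _ = ℓ ^ ε := by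
        have e : ℓ * ℓ = ℓ ^ (2 : ℝ) := by rw [ENNReal.rpow_two, sq]
        rw [e, ← ENNReal.rpow_sub _ _ hℓ hℓ']
        congr 1
        ring
    _ ≤ (M * ENNReal.ofReal (Real.exp (-((1 - 1 / 2) * φ γ)))) ^ ε := by gcongr
    _ = _ := by
        rw [ENNReal.mul_rpow_of_nonneg _ _ hε.le, ENNReal.ofReal_rpow_of_pos (Real.exp_pos _),
          ← Real.exp_mul]
        congr 3
        ring

end

/-! ### The exponential class: ratio tests along the integers. -/

section Exponential

variable {θ : ℝ} {μ : Measure ℝ}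

theorem ExponentialClass.tendsto_ratio (h : ExponentialClass θ μ) :
    Tendsto (fun n : ℕ => μ.real (Set.Ioi ((n + 1 : ℕ) : ℝ)) / μ.real (Set.Ioi (n : ℝ))) atTop
      (𝓝 (Real.exp (-θ))) := by
  have := (h 1).comp (tendsto_natCast_atTop_atTop (R := ℝ))
  simpa [Function.comp_def] using this

theorem ExponentialClass.summable_exp_mul_tail (h : ExponentialClass θ μ)
    (hunbdd : ∀ x, 0 < μ.real (Set.Ioi x)) {p : ℝ} (hp : p < θ) :
    Summable fun n : ℕ => Real.exp (p * n) * μ.real (Set.Ioi (n : ℝ)) := by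
  refine summable_of_ratio_test_tendsto_lt_one (l := Real.exp p * Real.exp (-θ)) ?_
    (Eventually.of_forall fun n => (mul_pos (Real.exp_pos _) (hunbdd _)).ne') ?_
  · rw [← Real.exp_add, Real.exp_lt_one_iff]
    linarith
  · refine (h.tendsto_ratio.const_mul (Real.exp p)).congr fun n => ?_
    rw [Real.norm_of_nonneg (mul_pos (Real.exp_pos _) (hunbdd _)).le,
      Real.norm_of_nonneg (mul_pos (Real.exp_pos _) (hunbdd _)).le, mul_div_mul_comm,
      ← Real.exp_sub]
    congr 2
    push_cast
    ring

theorem ExponentialClass.summable_exp_neg_div_tail (h : ExponentialClass θ μ)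
    (hunbdd : ∀ x, 0 < μ.real (Set.Ioi x)) {p : ℝ} (hp : θ < p) :
    Summable fun n : ℕ => Real.exp (-(p * n)) * (μ.real (Set.Ioi (n : ℝ)))⁻¹ := by
  have hpos : ∀ x, 0 < (μ.real (Set.Ioi x))⁻¹ := fun x => inv_pos.2 (hunbdd x)
  refine summable_of_ratio_test_tendsto_lt_one (l := Real.exp (-p) * (Real.exp (-θ))⁻¹) ?_
    (Eventually.of_forall fun n => (mul_pos (Real.exp_pos _) (hpos _)).ne') ?_
  · rw [← Real.exp_neg, ← Real.exp_add, Real.exp_lt_one_iff]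
    linarith
  · refine ((h.tendsto_ratio.inv₀ (Real.exp_pos _).ne').const_mul (Real.exp (-p))).congr
      fun n => ?_
    rw [Real.norm_of_nonneg (mul_pos (Real.exp_pos _) (hpos _)).le,
      Real.norm_of_nonneg (mul_pos (Real.exp_pos _) (hpos _)).le, mul_div_mul_comm,
      ← Real.exp_sub, inv_div_inv, inv_div]
    congr 2
    push_cast
    ring

/-- The tail ratio at consecutive integers tends to `exp (-θ)`. The terms `exp (-p n) / F̄(n)`, `p >
θ`, are thus bounded, which gives the lower tail bound; the sum of `exp (p n) F̄(n)`, `p < θ`, is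
finite, which gives the moments. -/
theorem ExponentialClass.hasTailExponent [IsProbabilityMeasure μ] (hθ : 0 < θ)
    (h : ExponentialClass θ μ) (hunbdd : ∀ x : ℝ, 0 < μ (Set.Ioi x)) :
    HasTailExponent (fun x => θ * x) μ := by
  have hunbdd' : ∀ x, 0 < μ.real (Set.Ioi x) := fun x =>
    ENNReal.toReal_pos (hunbdd x).ne' (measure_ne_top _ _)
  constructor
  · intro δ hδ
    have hp : θ < (1 + δ) * θ := by nlinarith
    obtain ⟨B, hB⟩ :=
      (h.summable_exp_neg_div_tail hunbdd' hp).tendsto_atTop_zero.bddAbove_range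
    have hB' : ∀ n : ℕ, Real.exp (-((1 + δ) * θ * n)) * (μ.real (Set.Ioi (n : ℝ)))⁻¹ ≤ B :=
      fun n => hB ⟨n, rfl⟩
    have hB0 : 0 ≤ B := (mul_pos (Real.exp_pos _) (inv_pos.2 (hunbdd' _))).le.trans (hB' 0)
    refine ⟨B * Real.exp ((1 + δ) * θ), by positivity, fun y hy => ?_⟩
    calc (μ (Set.Ioi y))⁻¹ ≤ (μ (Set.Ioi (⌈y⌉₊ : ℝ)))⁻¹ :=
          ENNReal.inv_le_inv.2 (measure_mono (Set.Ioi_subset_Ioi (Nat.le_ceil y)))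
      _ = ENNReal.ofReal (μ.real (Set.Ioi (⌈y⌉₊ : ℝ)))⁻¹ := by
          rw [ENNReal.ofReal_inv_of_pos (hunbdd' _), ofReal_measureReal]
      _ ≤ _ := by
          apply ENNReal.ofReal_le_ofReal
          have h1 := hB' ⌈y⌉₊
          rw [Real.exp_neg, inv_mul_le_iff₀ (Real.exp_pos _), mul_comm] at h1
          refine h1.trans ?_
          rw [mul_assoc B, ← Real.exp_add]
          gcongr
          have h2 := (Nat.ceil_lt_add_one hy).le
          have h3 := mul_le_mul_of_nonneg_left h2 (hθ.trans hp).le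
          linarith
  · intro δ hδ hδ1
    have hp : (1 - δ) * θ < θ := by nlinarith
    have hp0 : 0 < (1 - δ) * θ := mul_pos (by linarith) hθ
    set p := (1 - δ) * θ
    have hle : ∀ y, ENNReal.ofReal (Real.exp ((1 - δ) * (θ * y))) ≤ 1 + ∑' n : ℕ,
        (Set.Ioi (n : ℝ)).indicator (fun _ => ENNReal.ofReal (Real.exp (p * (n + 1)))) y := by
      intro y
      rw [← mul_assoc]
      rcases le_or_gt y 0 with hy | hy
      · refine le_trans ?_ le_self_add
        rw [ENNReal.ofReal_le_one, Real.exp_le_one_iff]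
        exact mul_nonpos_of_nonneg_of_nonpos hp0.le hy
      · refine le_trans ?_ le_add_self
        -- The index `n = ⌈y⌉ - 1` is the one with `n < y ≤ n + 1`.
        refine le_trans ?_ (ENNReal.le_tsum (⌈y⌉₊ - 1))
        have hc : 0 < ⌈y⌉₊ := Nat.ceil_pos.2 hy
        have hlt := Nat.ceil_lt_add_one hy.le
        have hcast : ((⌈y⌉₊ - 1 : ℕ) : ℝ) = (⌈y⌉₊ : ℝ) - 1 := by
          rw [Nat.cast_sub hc, Nat.cast_one]
        rw [Set.indicator_of_mem (by rw [Set.mem_Ioi, hcast]; linarith), hcast]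
        gcongr
        linarith [Nat.le_ceil y]
    refine ne_top_of_le_ne_top ?_ (lintegral_mono hle)
    rw [lintegral_add_left measurable_const, lintegral_tsum fun n =>
      (measurable_const.indicator measurableSet_Ioi).aemeasurable]
    refine ENNReal.add_ne_top.2 ⟨by simp, ?_⟩
    have hs := ((h.summable_exp_mul_tail hunbdd' hp).mul_left (Real.exp p)).tsum_ofReal_ne_top
    convert hs using 3 with n
    rw [lintegral_indicator_const measurableSet_Ioi, ← mul_assoc, ← Real.exp_add,
      ENNReal.ofReal_mul (Real.exp_pos _).le, ofReal_measureReal]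
    congr 3
    ring

end Exponential

/-! ### Tail exponents of the Weibull and Pareto laws. -/

theorem measurable_weibull_density (α : ℝ) : Measurable fun x : ℝ => ENNReal.ofReal
    (if 0 < x then α * x ^ (α - 1) * Real.exp (-(x ^ α)) else 0) := by
  refine (Measurable.ite measurableSet_Ioi ?_ measurable_const).ennreal_ofReal
  fun_prop

theorem measurable_pareto_density (α : ℝ) : Measurable fun x : ℝ => ENNReal.ofReal
    (if 1 ≤ x then α / x ^ (α + 1) else 0) := by
  refine (Measurable.ite measurableSet_Ici ?_ measurable_const).ennreal_ofReal
  fun_prop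

theorem weibullLaw_Ioi {α : ℝ} (hα : 0 < α) {y : ℝ} (hy : 0 ≤ y) :
    weibullLaw α (Set.Ioi y) = ENNReal.ofReal (Real.exp (-(y ^ α))) := by
  have hd : ∀ x ∈ Set.Ioi y, HasDerivAt (fun x : ℝ => -Real.exp (-(x ^ α)))
      (α * x ^ (α - 1) * Real.exp (-(x ^ α))) x := by
    intro x hx
    have hx0 : 0 < x := hy.trans_lt hx
    have h := ((Real.hasDerivAt_rpow_const (p := α) (Or.inl hx0.ne')).neg.exp).neg
    refine h.congr_deriv ?_
    rw [Pi.neg_apply]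
    ring
  have hnn : ∀ x ∈ Set.Ioi y, 0 ≤ α * x ^ (α - 1) * Real.exp (-(x ^ α)) := by
    intro x hx
    have hx0 : 0 < x := hy.trans_lt hx
    positivity
  have hcont : ContinuousWithinAt (fun x : ℝ => -Real.exp (-(x ^ α))) (Set.Ici y) y := by
    have : Continuous fun x : ℝ => x ^ α := continuous_id.rpow_const fun _ => Or.inr hα.le
    exact (this.neg.rexp.neg).continuousWithinAt
  have hlim : Tendsto (fun x : ℝ => -Real.exp (-(x ^ α))) atTop (𝓝 (-0)) :=
    (Real.tendsto_exp_neg_atTop_nhds_zero.comp (tendsto_rpow_atTop hα)).neg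
  have hint := integrableOn_Ioi_deriv_of_nonneg hcont hd hnn hlim
  have hval := integral_Ioi_of_hasDerivAt_of_nonneg hcont hd hnn hlim
  rw [weibullLaw, withDensity_apply _ measurableSet_Ioi]
  rw [setLIntegral_congr_fun (g := fun x => ENNReal.ofReal
    (α * x ^ (α - 1) * Real.exp (-(x ^ α)))) measurableSet_Ioi]
  · rw [← ofReal_integral_eq_lintegral_ofReal hint
      ((ae_restrict_iff' measurableSet_Ioi).2 (Eventually.of_forall hnn)), hval]
    simp
  · intro x hx
    simp [hy.trans_lt hx]

theorem hasTailExponent_weibullLaw {α : ℝ} (hα : 0 < α) :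
    HasTailExponent (fun x => x ^ α) (weibullLaw α) where
  lower δ hδ := by
    refine ⟨1, zero_le_one, fun y hy => ?_⟩
    rw [weibullLaw_Ioi hα hy, ← ENNReal.ofReal_inv_of_pos (Real.exp_pos _), Real.exp_neg, inv_inv,
      one_mul]
    have : 0 ≤ y ^ α := Real.rpow_nonneg hy _
    gcongr
    nlinarith
  upper δ hδ _ := by
    rw [weibullLaw, lintegral_withDensity_eq_lintegral_mul _ (measurable_weibull_density α)
      (by fun_prop)]
    have hint := (integrableOn_rpow_mul_exp_neg_mul_rpow (s := α - 1) (by linarith) hα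
      hδ).const_mul α
    refine ne_top_of_le_ne_top hint.lintegral_lt_top.ne ?_
    rw [← lintegral_indicator measurableSet_Ioi]
    refine lintegral_mono fun x => ?_
    by_cases hx : 0 < x
    · simp only [Pi.mul_apply, if_pos hx, Set.indicator_of_mem (Set.mem_Ioi.2 hx)]
      rw [← ENNReal.ofReal_mul (by positivity)]
      apply ENNReal.ofReal_le_ofReal
      rw [mul_assoc, mul_assoc, ← Real.exp_add]
      apply le_of_eq
      congr 3
      ring
    · simp [hx]

theorem paretoLaw_Ioi {α : ℝ} (hα : 0 < α) {y : ℝ} (hy : 1 ≤ y) :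
    paretoLaw α (Set.Ioi y) = ENNReal.ofReal (y ^ (-α)) := by
  have hy0 : 0 < y := by linarith
  have hint := (integrableOn_Ioi_rpow_of_lt (a := -α - 1) (by linarith) hy0).const_mul α
  have hnn : ∀ x ∈ Set.Ioi y, 0 ≤ α * x ^ (-α - 1) := by
    intro x hx
    have : 0 < x := hy0.trans hx
    positivity
  rw [paretoLaw, withDensity_apply _ measurableSet_Ioi]
  rw [setLIntegral_congr_fun (g := fun x => ENNReal.ofReal (α * x ^ (-α - 1))) measurableSet_Ioi]
  · rw [← ofReal_integral_eq_lintegral_ofReal hint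
      ((ae_restrict_iff' measurableSet_Ioi).2 (Eventually.of_forall hnn)), integral_const_mul,
      integral_Ioi_rpow_of_lt (by linarith) hy0]
    congr 1
    rw [sub_add_cancel, neg_div_neg_eq]
    field_simp
  · intro x hx
    have hx0 : 0 < x := hy0.trans hx
    have hx1 : 1 ≤ x := hy.trans (le_of_lt hx)
    dsimp only
    rw [if_pos hx1, show -α - 1 = -(α + 1) by ring, Real.rpow_neg hx0.le, div_eq_mul_inv]

theorem hasTailExponent_paretoLaw {α : ℝ} (hα : 0 < α) :
    HasTailExponent (fun x => α * Real.log (1 + max x 0)) (paretoLaw α) where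
  lower δ hδ := by
    refine ⟨1, zero_le_one, fun y hy => ?_⟩
    -- Shifting by `1` enters the region where the tail is an exact power and matches the `1 +` in
    -- the exponent.
    have h1 : paretoLaw α (Set.Ioi (1 + y)) ≤ paretoLaw α (Set.Ioi y) :=
      measure_mono (Set.Ioi_subset_Ioi (by linarith))
    refine (ENNReal.inv_le_inv.2 h1).trans ?_
    have hy1 : 0 < 1 + y := by linarith
    have hl : 0 ≤ Real.log (1 + y) := Real.log_nonneg (by linarith)
    rw [paretoLaw_Ioi hα (by linarith), ← ENNReal.ofReal_inv_of_pos (by positivity),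
      Real.rpow_neg hy1.le, inv_inv, one_mul, max_eq_left hy, Real.rpow_def_of_pos hy1]
    apply ENNReal.ofReal_le_ofReal
    apply Real.exp_le_exp.2
    have := mul_nonneg hδ.le (mul_nonneg hα.le hl)
    linarith
  upper δ hδ hδ1 := by
    rw [paretoLaw, lintegral_withDensity_eq_lintegral_mul _ (measurable_pareto_density α)
      (by fun_prop)]
    have hδα : 0 < δ * α := by positivity
    have hint := ((integrableOn_Ici_iff_integrableOn_Ioi (by simp)).2
      (integrableOn_Ioi_rpow_of_lt (a := -(δ * α) - 1) (by linarith) one_pos)).const_mul (α * 2 ^ ((1 - δ) * α))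
    refine ne_top_of_le_ne_top hint.lintegral_lt_top.ne ?_
    rw [← lintegral_indicator measurableSet_Ici]
    refine lintegral_mono fun x => ?_
    by_cases hx : 1 ≤ x
    · have hx0 : 0 < x := by linarith
      simp only [Pi.mul_apply, if_pos hx, Set.indicator_of_mem (Set.mem_Ici.2 hx)]
      rw [← ENNReal.ofReal_mul (by positivity)]
      apply ENNReal.ofReal_le_ofReal
      have hq : 0 ≤ (1 - δ) * α := mul_nonneg (by linarith) hα.le
      -- Uses `1 + x ≤ 2 x` for `x ≥ 1`; the product with the density is then of order `x ^ (-δα -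
      -- 1)`.
      have h2 : Real.exp ((1 - δ) * (α * Real.log (1 + max x 0)))
          ≤ 2 ^ ((1 - δ) * α) * x ^ ((1 - δ) * α) := by
        rw [max_eq_left hx0.le, ← Real.mul_rpow zero_le_two hx0.le, ← mul_assoc,
          mul_comm ((1 - δ) * α), ← Real.rpow_def_of_pos (by linarith)]
        exact Real.rpow_le_rpow (by linarith) (by linarith) hq
      calc α / x ^ (α + 1) * Real.exp ((1 - δ) * (α * Real.log (1 + max x 0)))
          ≤ α / x ^ (α + 1) * (2 ^ ((1 - δ) * α) * x ^ ((1 - δ) * α)) := by gcongr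
        _ = α * 2 ^ ((1 - δ) * α) * (x ^ ((1 - δ) * α) / x ^ (α + 1)) := by ring
        _ = _ := by
            rw [← Real.rpow_sub hx0]
            congr 2
            ring
    · simp [hx]

end SemiparametricCE

theorem mainTheorem2 {Ω : Type*} [MeasurableSpace Ω] (P : Measure Ω) [IsProbabilityMeasure P]
    (d : ℕ) (hd : 0 < d) (X : Fin d → Ω → ℝ) (f₁ : ℝ → ℝ≥0) (hf₁ : Measurable f₁)
    (hlaw : ∀ i, HasLaw (X i) (SemiparametricCE.densityLaw f₁) P)
    (hindep : iIndepFun X P)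
    (hpos : SemiparametricCE.densityLaw f₁ (Set.Iic 0) = 0)
    (hunbdd : ∀ x : ℝ, 0 < SemiparametricCE.densityLaw f₁ (Set.Ioi x))
    (hclass :
      (∃ θ : ℝ, 0 < θ ∧ SemiparametricCE.ExponentialClass θ (SemiparametricCE.densityLaw f₁)) ∨
      (∃ α : ℝ, 0 < α ∧ α < 1 ∧
        SemiparametricCE.densityLaw f₁ = SemiparametricCE.weibullLaw α) ∨
      (∃ α : ℝ, 0 < α ∧ SemiparametricCE.densityLaw f₁ = SemiparametricCE.paretoLaw α)) :
    SemiparametricCE.LogEfficient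
      (fun γ => SemiparametricCE.secondMoment (SemiparametricCE.jointDensity d f₁)
        (SemiparametricCE.rareProb P X γ) γ)
      (fun γ => SemiparametricCE.rareProb P X γ) := by
  have : IsProbabilityMeasure (SemiparametricCE.densityLaw f₁) := by
    rw [← (hlaw ⟨0, hd⟩).map_eq]
    exact Measure.isProbabilityMeasure_map (hlaw ⟨0, hd⟩).aemeasurable
  obtain ⟨φ, hφ, htail⟩ : ∃ φ, SemiparametricCE.TailExponent φ ∧
      SemiparametricCE.HasTailExponent φ (SemiparametricCE.densityLaw f₁) := by
    rcases hclass with ⟨θ, hθ, h⟩ | ⟨α, hα, hα1, h⟩ | ⟨α, hα, h⟩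
    · exact ⟨_, SemiparametricCE.TailExponent.id.const_mul hθ, h.hasTailExponent hθ hunbdd⟩
    · exact ⟨_, SemiparametricCE.TailExponent.rpow hα hα1,
        h ▸ SemiparametricCE.hasTailExponent_weibullLaw hα⟩
    · exact ⟨_, SemiparametricCE.TailExponent.log_one_add.const_mul hα,
        h ▸ SemiparametricCE.hasTailExponent_paretoLaw hα⟩
  obtain rfl | hd2 : d = 1 ∨ 2 ≤ d := by omega
  · exact SemiparametricCE.logEfficient_of_eq_one hf₁ hlaw hindep hpos hunbdd hφ htail
  · exact SemiparametricCE.logEfficient_of_two_le hd2 hf₁ hlaw hindep hpos hunbdd hφ htail
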